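/- A probabilistic open channel system (pOCS) $\mathcal S=(Q,Ch,\Sigma,\Delta,W)$ consists of a finite set $Q$ of states, a finite set $Ch$ of channels with a distinguished input channel $c_{in}\in Ch$, a finite alphabet $\Sigma$ with a distinguished letter $\$\in\Sigma$, a transition relation $\Delta\subseteq Q\times Ch\times(\Sigma\cup\{\lambda\})\times Ch\times(\Sigma\cup\{\lambda\})\times Q$, where $\lambda$ is the empty word, such that 1. $(q,c_{in},\lambda,c_{in},\$,q)\in\Delta$ for all $q\in Q$; 2. for all $(q,c,a,c',a',q')\in\Delta$, if $a=\lambda$ then $a'=\$$ and $c=c'=c_{in}$; 3. for all $(q,c,a,c',a',q')\in\Delta$, if $c\neq c_{in}$ then $c'\neq c_{in}$; and a weight function $W:\Delta\times(\Sigma^*)^{Ch}\to\mathbb Q_{>0}$. Its configurations are the pairs $(q,\nu)\in Q\times(\Sigma^*)^{Ch}$. A transition $t=(q,c,a,c',a',q')$ is enabled in $(q,\nu)$ if $\nu(c)=aw$ for some word $w$; firing it replaces the state by $q'$, removes $a$ from the head of channel $c$ and then appends $a'$ to the tail of channel $c'$. The Markov chain $\mathcal M_{\mathcal S}$ on the configurations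 draws in $(q,\nu)$ an enabled transition $t$ with probability proportional to $W(t,\nu)$ and fires it. A configuration $s_1$ is reachable from $s_0$ if $\mathcal M_{\mathcal S}$ leads from $s_0$ to $s_1$ by finitely many (possibly zero) steps of positive probability. The reachability problem of pOCS is: given a pOCS $\mathcal S$ (finitely presented by $Q$, $Ch$, $c_{in}$, $\Sigma$, $\$$, $\Delta$, and a program computing $W$) and two configurations $s_0,s_1$ of $\mathcal S$, decide whether $s_1$ is reachable from $s_0$ in $\mathcal M_{\mathcal S}$. **Proposition.** The reachability problem of pOCS is undecidable: there is no algorithm that halts on every such input with the correct answer. -/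

import Mathlib

/-- A transition `(q, c, a, c', a', q')`; `none` stands for the empty word `λ`. -/
abbrev Transition (Q Ch A : Type) : Type :=
  Q × Ch × Option A × Ch × Option A × Q

/-- A configuration `(q, ν)`: a state and a word in every channel. -/
abbrev Config (Q Ch A : Type) : Type :=
  Q × (Ch → List A)

/-- A probabilistic open channel system with set of states `Q`, set of channels `Ch` and
alphabet `A`. -/
structure POCS (Q Ch A : Type) [Finite Q] [Finite Ch] [Finite A] where
  /-- The input channel `c_in`. -/
  cin : Ch
  /-- The letter `$` for anonymous clients. -/
  client : A
  /-- The transition relation `Δ`. -/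
  trans : Finset (Transition Q Ch A)
  /-- Client arrivals are possible in every state. -/
  arrival_mem : ∀ q : Q, (q, cin, none, cin, some client, q) ∈ trans
  /-- A transition that consumes nothing is an arrival of `$` in the input channel. -/
  arrival_only : ∀ q c a c' a' q', (q, c, a, c', a', q') ∈ trans →
    a = none → a' = some client ∧ c = cin ∧ c' = cin
  /-- No transition leads from another channel to the input channel. -/
  no_return : ∀ q c a c' a' q', (q, c, a, c', a', q') ∈ trans → c ≠ cin → c' ≠ cin
  /-- The weight function, which may depend on the contents of the channels. -/
  weight : {t // t ∈ trans} → (Ch → List A) → ℚ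
  weight_pos : ∀ t ν, 0 < weight t ν

section Firing

variable {Q Ch A : Type}

/-- The transition `(q, c, a, c', a', q')` is enabled in `(q, ν)` if `ν c = a w` for some `w`. -/
def Transition.Enabled : Transition Q Ch A → Config Q Ch A → Prop
  | (q, c, a, _, _, _), s => s.1 = q ∧ ∃ w : List A, s.2 c = a.toList ++ w

/-- The configuration reached by firing `(q, c, a, c', a', q')`: the letter `a` is removed from
the head of `c`, and then `a'` is appended to the tail of `c'`. (Relevant only if the transition
is enabled.) -/
def Transition.fire [DecidableEq Ch] : Transition Q Ch A → Config Q Ch A → Config Q Ch A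
  | (_, c, a, c', a', q'), s =>
    let ν₁ := Function.update s.2 c ((s.2 c).drop a.toList.length)
    (q', Function.update ν₁ c' (ν₁ c' ++ a'.toList))

end Firing

namespace POCS

variable {Q Ch A : Type} [Finite Q] [Finite Ch] [Finite A]

/-- The transitions of `S` enabled in the configuration `s`. -/
abbrev EnabledTrans (S : POCS Q Ch A) (s : Config Q Ch A) : Type :=
  {t : {t // t ∈ S.trans} // Transition.Enabled t.1 s}

/-- The weight of an enabled transition as an extended nonnegative real. -/
noncomputable def enabledWeight (S : POCS Q Ch A) (s : Config Q Ch A)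
    (t : S.EnabledTrans s) : ENNReal :=
  ENNReal.ofReal ((S.weight t.1 s.2 : ℚ) : ℝ)

theorem tsum_enabledWeight_ne_zero (S : POCS Q Ch A) (s : Config Q Ch A) :
    ∑' t, S.enabledWeight s t ≠ 0 := by
  intro h
  have h1 := ENNReal.tsum_eq_zero.mp h
    ⟨⟨_, S.arrival_mem s.1⟩, rfl, s.2 S.cin, by simp⟩
  have h2 := S.weight_pos ⟨_, S.arrival_mem s.1⟩ s.2
  simp only [enabledWeight, ENNReal.ofReal_eq_zero] at h1
  exact absurd h1 (not_le.mpr (by exact_mod_cast h2))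

theorem tsum_enabledWeight_ne_top (S : POCS Q Ch A) (s : Config Q Ch A) :
    ∑' t, S.enabledWeight s t ≠ ⊤ := by
  have : Fintype (S.EnabledTrans s) := Fintype.ofFinite _
  rw [tsum_fintype]
  exact ENNReal.sum_ne_top.mpr fun t _ => ENNReal.ofReal_ne_top

/-- The Markov chain of `S`: in the configuration `s`, an enabled transition is drawn with
probability proportional to its weight, and it is fired. -/
noncomputable def markovChain [DecidableEq Ch] (S : POCS Q Ch A) (s : Config Q Ch A) :
    PMF (Config Q Ch A) :=
  (PMF.normalize (S.enabledWeight s) (S.tsum_enabledWeight_ne_zero s)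
    (S.tsum_enabledWeight_ne_top s)).map fun t => Transition.fire t.1.1 s

/-- `s'` is reachable from `s` by finitely many (possibly zero) steps of positive probability. -/
def Reachable [DecidableEq Ch] (S : POCS Q Ch A) (s s' : Config Q Ch A) : Prop :=
  Relation.ReflTransGen (fun u v => 0 < S.markovChain u v) s s'

end POCS

section Coding

variable {n m k : ℕ}

/-- A transition over initial segments of `ℕ`, written with natural numbers. -/
def codeTrans : Transition (Fin n) (Fin m) (Fin k) → Transition ℕ ℕ ℕ
  | (q, c, a, c', a', q') => (q, c, a.map Fin.val, c', a'.map Fin.val, q')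

/-- The contents of the channels `0, 1, …, m - 1`, written as a list of `m` words. -/
def codeChannels (ν : Fin m → List (Fin k)) : List (List ℕ) :=
  List.ofFn fun c => (ν c).map Fin.val

/-- A configuration, written with natural numbers. -/
def codeConfig (s : Config (Fin n) (Fin m) (Fin k)) : ℕ × List (List ℕ) :=
  (s.1, codeChannels s.2)

/-- The finite data that describe an input of the reachability problem: the numbers of states,
channels and letters; the numbers of the input channel and of `$`; a list of the transitions;
a program for the weight function; the initial and the final configuration. -/
abbrev ReachInput : Type :=
  (ℕ × ℕ × ℕ) × (ℕ × ℕ) × List (Transition ℕ ℕ ℕ) × Nat.Partrec.Code ×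
    (ℕ × List (List ℕ)) × (ℕ × List (List ℕ))

/-- The program `e` computes the weight function of `S`: on a transition of `S` and the contents
of the channels it halts and returns the numerator and the denominator of the weight. -/
def ComputesWeight (S : POCS (Fin n) (Fin m) (Fin k)) (e : Nat.Partrec.Code) : Prop :=
  ∀ (t : {t // t ∈ S.trans}) (ν : Fin m → List (Fin k)),
    Nat.pair (S.weight t ν).num.natAbs (S.weight t ν).den ∈
      e.eval (Encodable.encode (codeTrans t.1, codeChannels ν))

/-- `x` describes the probabilistic open channel system `S` together with the configurations
`s₀` and `s₁`. -/
def Describes (x : ReachInput) (S : POCS (Fin n) (Fin m) (Fin k))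
    (s₀ s₁ : Config (Fin n) (Fin m) (Fin k)) : Prop :=
  ∃ (l : List (Transition ℕ ℕ ℕ)) (e : Nat.Partrec.Code),
    (∀ u, u ∈ l ↔ ∃ t ∈ S.trans, codeTrans t = u) ∧ ComputesWeight S e ∧
    x = ((n, m, k), ((S.cin : ℕ), (S.client : ℕ)), l, e, codeConfig s₀, codeConfig s₁)

end Coding

/-! The halting problem is reduced to reachability. All weights are positive, so a step has positive
probability iff some enabled transition performs it (`markovChain_pos_iff`); weights can be
constantly 1 and only the transition relation matters. One fixed stack machine, evaluating programs
given by their codes, is simulated. Each stack is a channel closed by an end marker; a push appends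
the letter behind the marker and then rotates the queue until the marker is last again. No internal
transition may consume nothing, so pushes and silent moves are paid for by a client letter from the
input channel. Arrivals are always possible, so this never blocks, and surplus clients do no harm.
After halting, all channels can be emptied, which makes a single target configuration sufficient.
`exists_represents_stepAux` turns runs of the machine into runs of the channel system, `Inv.step`
gives the converse, and `reflTransGen_iff_dom` combines them. Only the initial content of one
channel depends on the program to be tested, so the reduction is computable. -/

namespace POCS

/-! ### Transport from finite types to initial segments of `ℕ`. -/

section Relabel

variable {Q Ch A : Type} {n m k : ℕ}

/-- A transition relation on finite types, relabelled by initial segments of `ℕ`. -/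
def relabelTrans (eQ : Q ≃ Fin n) (eC : Ch ≃ Fin m) (eA : A ≃ Fin k) :
    Transition Q Ch A ≃ Transition (Fin n) (Fin m) (Fin k) :=
  eQ.prodCongr (eC.prodCongr ((Equiv.optionCongr eA).prodCongr
    (eC.prodCongr ((Equiv.optionCongr eA).prodCongr eQ))))

/-- A configuration over finite types, relabelled by initial segments of `ℕ`. -/
def relabelConfig (eQ : Q ≃ Fin n) (eC : Ch ≃ Fin m) (eA : A ≃ Fin k) :
    Config Q Ch A ≃ Config (Fin n) (Fin m) (Fin k) :=
  eQ.prodCongr (eC.arrowCongr (Equiv.listEquivOfEquiv eA))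

variable (eQ : Q ≃ Fin n) (eC : Ch ≃ Fin m) (eA : A ≃ Fin k)

theorem relabelConfig_apply (s : Config Q Ch A) :
    relabelConfig eQ eC eA s = (eQ s.1, fun c => (s.2 (eC.symm c)).map eA) := rfl

theorem enabled_relabel (t : Transition Q Ch A) (s : Config Q Ch A) :
    (relabelTrans eQ eC eA t).Enabled (relabelConfig eQ eC eA s) ↔ t.Enabled s := by
  obtain ⟨q, c, a, c', a', q'⟩ := t
  cases a with
  | none => simp [relabelTrans, relabelConfig_apply, Transition.Enabled]
  | some a =>
    simp only [relabelTrans, Equiv.prodCongr_apply, Prod.map, Transition.Enabled,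
      relabelConfig_apply, Equiv.apply_eq_iff_eq, Equiv.symm_apply_apply]
    refine and_congr Iff.rfl ⟨?_, ?_⟩
    · rintro ⟨w, hw⟩
      rcases h : s.2 c with _ | ⟨b, l⟩
      · simp [h] at hw
      · simp only [h] at hw
        exact ⟨l, by simpa using (List.cons.inj hw).1⟩
    · rintro ⟨w, hw⟩
      exact ⟨w.map eA, by simp [hw]⟩

theorem fire_relabel [DecidableEq Ch] (t : Transition Q Ch A) (s : Config Q Ch A) :
    (relabelTrans eQ eC eA t).fire (relabelConfig eQ eC eA s) =
      relabelConfig eQ eC eA (t.fire s) := by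
  obtain ⟨q, c, a, c', a', q'⟩ := t
  have h (ν : Ch → List A) (d : Ch) (l : List A) :
      (fun x => (Function.update ν d l (eC.symm x)).map eA) =
        Function.update (fun x => (ν (eC.symm x)).map eA) (eC d) (l.map eA) := by
    funext x
    by_cases hx : x = eC d
    · subst hx; simp
    · rw [Function.update_of_ne hx, Function.update_of_ne]
      rwa [ne_eq, Equiv.symm_apply_eq]
  have h' (o : Option A) : (o.map eA).toList = o.toList.map eA := by cases o <;> rfl
  simp only [relabelTrans, Equiv.prodCongr_apply, Prod.map, Transition.fire,
    relabelConfig_apply, h, Equiv.optionCongr_apply, h', List.map_append, List.map_drop,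
    List.length_map, Equiv.symm_apply_apply]
  congr 2
  have := congrFun (h s.2 c ((s.2 c).drop a.toList.length)) (eC c')
  simp only [Equiv.symm_apply_apply, List.map_drop] at this
  rw [this]

end Relabel

/-! ### Positive probability as firing of a transition; systems given by a rule. -/

section Steps

variable {Q Ch A : Type}

/-- One step of the channel system whose transitions satisfy `rule`. -/
def Step [DecidableEq Ch] (rule : Transition Q Ch A → Prop) (u v : Config Q Ch A) : Prop :=
  ∃ t, rule t ∧ t.Enabled u ∧ t.fire u = v

theorem markovChain_pos_iff [Finite Q] [Finite Ch] [Finite A] [DecidableEq Ch] (S : POCS Q Ch A)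
    (u v : Config Q Ch A) : 0 < S.markovChain u v ↔ Step (· ∈ S.trans) u v := by
  rw [pos_iff_ne_zero, ← PMF.mem_support_iff, markovChain, PMF.support_map]
  simp only [PMF.support_normalize, Set.mem_image, Function.mem_support]
  constructor
  · rintro ⟨t, -, rfl⟩
    exact ⟨t.1.1, t.1.2, t.2, rfl⟩
  · rintro ⟨t, ht, he, rfl⟩
    refine ⟨⟨⟨t, ht⟩, he⟩, ?_, rfl⟩
    simp only [enabledWeight, ne_eq, ENNReal.ofReal_eq_zero, not_le]
    exact_mod_cast S.weight_pos _ _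

/-- The conditions on the transition relation of a probabilistic open channel system. -/
structure IsOpen (cin : Ch) (client : A) (rule : Transition Q Ch A → Prop) : Prop where
  arrival_mem : ∀ q : Q, rule (q, cin, none, cin, some client, q)
  arrival_only : ∀ q c a c' a' q', rule (q, c, a, c', a', q') →
    a = none → a' = some client ∧ c = cin ∧ c' = cin
  no_return : ∀ q c a c' a' q', rule (q, c, a, c', a', q') → c ≠ cin → c' ≠ cin

variable {n m k : ℕ} (eQ : Q ≃ Fin n) (eC : Ch ≃ Fin m) (eA : A ≃ Fin k)
  {cin : Ch} {client : A} {rule : Transition Q Ch A → Prop}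

open Classical in
/-- The probabilistic open channel system with transitions given by `rule`, relabelled by initial
segments of `ℕ`, where all weights are equal. -/
noncomputable def ofRule (hr : IsOpen cin client rule) : POCS (Fin n) (Fin m) (Fin k) where
  cin := eC cin
  client := eA client
  trans := Finset.univ.filter fun t => rule ((relabelTrans eQ eC eA).symm t)
  arrival_mem q := by
    simpa [relabelTrans, ← Equiv.optionCongr_symm] using hr.arrival_mem (eQ.symm q)
  arrival_only q c a c' a' q' h ha := by
    subst ha
    have := hr.arrival_only _ _ _ _ _ _ (Finset.mem_filter.mp h).2 rfl
    simpa [Equiv.symm_apply_eq, Option.map_eq_some_iff] using this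
  no_return q c a c' a' q' h hc := by
    have := hr.no_return _ _ _ _ _ _ (Finset.mem_filter.mp h).2
    simp only [ne_eq, Equiv.symm_apply_eq] at this
    exact this hc
  weight _ _ := 1
  weight_pos _ _ := one_pos

theorem reachable_ofRule_iff [DecidableEq Ch] (hr : IsOpen cin client rule)
    (s s' : Config Q Ch A) :
    (ofRule eQ eC eA hr).Reachable (relabelConfig eQ eC eA s) (relabelConfig eQ eC eA s') ↔
      Relation.ReflTransGen (Step rule) s s' := by
  have key (u v : Config Q Ch A) :
      0 < (ofRule eQ eC eA hr).markovChain (relabelConfig eQ eC eA u) (relabelConfig eQ eC eA v) ↔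
        Step rule u v := by
    rw [markovChain_pos_iff, Step, (relabelTrans eQ eC eA).surjective.exists]
    simp only [enabled_relabel, fire_relabel, Equiv.apply_eq_iff_eq]
    simp [Step, ofRule]
  constructor
  · intro h
    have := Relation.ReflTransGen.lift (p := Step rule) (relabelConfig eQ eC eA).symm
      (fun a b hab => (key _ _).mp (by simpa using hab)) _ _ h
    simpa [Function.onFun] using this
  · exact Relation.ReflTransGen.lift (relabelConfig eQ eC eA) (fun a b hab => (key a b).mpr hab) _ _

theorem describes_ofRule (hr : IsOpen cin client rule)
    (s₀ s₁ : Config (Fin n) (Fin m) (Fin k)) :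
    Describes ((n, m, k), ((eC cin : ℕ), (eA client : ℕ)),
      (ofRule eQ eC eA hr).trans.toList.map codeTrans,
      Nat.Partrec.Code.const (Nat.pair 1 1), codeConfig s₀, codeConfig s₁)
      (ofRule eQ eC eA hr) s₀ s₁ := by
  refine ⟨_, _, fun u => by simp, fun t ν => ?_, rfl⟩
  simp [ofRule]

end Steps

end POCS

/-! ### Simulation of a stack machine by channels. -/

namespace StackSimulation

open Turing Turing.TM2

variable {K Γ Λ σ : Type}

/-- A set of statements that contains all statements a run through one of them leads to. -/
structure Closed (M : Λ → Stmt (fun _ : K => Γ) Λ σ) (T : Set (Stmt (fun _ : K => Γ) Λ σ)) :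
    Prop where
  push : ∀ {k f q}, .push k f q ∈ T → q ∈ T
  peek : ∀ {k f q}, .peek k f q ∈ T → q ∈ T
  pop : ∀ {k f q}, .pop k f q ∈ T → q ∈ T
  load : ∀ {f q}, .load f q ∈ T → q ∈ T
  branch : ∀ {f q₁ q₂}, .branch f q₁ q₂ ∈ T → ∀ v, (bif f v then q₁ else q₂) ∈ T
  goto : ∀ {f}, .goto f ∈ T → ∀ v, M (f v) ∈ T

theorem closed_stmts [Inhabited Λ] {M : Λ → Stmt (fun _ : K => Γ) Λ σ} {S : Finset Λ}
    (hS : Supports M S) : Closed M {q | some q ∈ stmts M S} where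
  push := stmts_trans (by simp [stmts₁, stmts₁_self])
  peek := stmts_trans (by simp [stmts₁, stmts₁_self])
  pop := stmts_trans (by simp [stmts₁, stmts₁_self])
  load := stmts_trans (by simp [stmts₁, stmts₁_self])
  branch {f q₁ q₂} h v := by
    refine stmts_trans ?_ h
    cases f v <;> simp [stmts₁, stmts₁_self]
  goto {f} h v := by
    have := stmts_supportsStmt hS h v
    simp only [stmts, Set.mem_ofPred_eq, Finset.some_mem_insertNone, Finset.mem_biUnion]
    exact ⟨_, this, stmts₁_self⟩

/-- The control states of the channel system: `halted`, `run q v` and `rotate k q v`. -/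
abbrev Control (K σ : Type) {X : Type} (T : Set X) : Type :=
  Option (Option K × T × σ)

section

variable {X : Type} {T : Set X}

/-- The simulated machine has halted, and the channels are being emptied. -/
abbrev halted : Control K σ T := none

/-- The statement `q` is about to be executed with internal state `v`. -/
abbrev run (q : T) (v : σ) : Control K σ T := some (none, q, v)

/-- The word in channel `k` is rotated up to its end marker, then `q` is executed. -/
abbrev rotate (k : K) (q : T) (v : σ) : Control K σ T := some (some k, q, v)

end

/-- The transitions of a channel system that simulates the stack machine `M`. The input channel is
`none`, and the stack `k` is kept in the channel `some k`, followed by the end marker `none`, which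
is the letter for anonymous clients as well. A letter is pushed at the tail of a channel, which is
then rotated. -/
inductive Rule (M : Λ → Stmt (fun _ : K => Γ) Λ σ) (T : Set (Stmt (fun _ : K => Γ) Λ σ)) :
    Transition (Control K σ T) (Option K) (Option Γ) → Prop
  | arrival (s) : Rule M T (s, none, none, none, some none, s)
  | push (k f q v h h') : Rule M T
      (run ⟨.push k f q, h⟩ v, none, some none, some k, some (some (f v)), rotate k ⟨q, h'⟩ v)
  | peek (k f q v h h' g) : Rule M T (run ⟨.peek k f q, h⟩ v, some k, some (some g),
      some k, some (some g), rotate k ⟨q, h'⟩ (f v (some g)))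
  | peekEmpty (k f q v h h') : Rule M T (run ⟨.peek k f q, h⟩ v, some k, some none,
      some k, some none, run ⟨q, h'⟩ (f v none))
  | pop (k f q v h h' g) : Rule M T (run ⟨.pop k f q, h⟩ v, some k, some (some g),
      some k, none, run ⟨q, h'⟩ (f v (some g)))
  | popEmpty (k f q v h h') : Rule M T (run ⟨.pop k f q, h⟩ v, some k, some none,
      some k, some none, run ⟨q, h'⟩ (f v none))
  | load (f q v h h') : Rule M T
      (run ⟨.load f q, h⟩ v, none, some none, none, none, run ⟨q, h'⟩ (f v))
  | branch (f q₁ q₂ v h h') : Rule M T (run ⟨.branch f q₁ q₂, h⟩ v, none, some none, none, none,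
      run ⟨bif f v then q₁ else q₂, h'⟩ v)
  | goto (f v h h') : Rule M T
      (run ⟨.goto f, h⟩ v, none, some none, none, none, run ⟨M (f v), h'⟩ v)
  | halt (v h) : Rule M T (run ⟨.halt, h⟩ v, none, some none, none, none, halted)
  | rotate (k q v g) : Rule M T
      (rotate k q v, some k, some (some g), some k, some (some g), rotate k q v)
  | rotateEnd (k q v) : Rule M T
      (rotate k q v, some k, some none, some k, some none, run q v)
  | clear (c a) : Rule M T (halted, c, some a, c, none, halted)

theorem isOpen_rule (M : Λ → Stmt (fun _ : K => Γ) Λ σ) (T) :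
    POCS.IsOpen none none (Rule M T) where
  arrival_mem := .arrival
  arrival_only := by rintro q c a c' a' q' h rfl; cases h; simp
  no_return := by rintro q c a c' a' q' h hc; cases h <;> simp_all

/-- The contents of the channels that represent the stacks `S`. -/
def channels (S : K → List Γ) : Option K → List (Option Γ)
  | none => []
  | some k => (S k).map some ++ [none]

variable [DecidableEq K] {M : Λ → Stmt (fun _ : K => Γ) Λ σ}
  {T : Set (Stmt (fun _ : K => Γ) Λ σ)}

/-- The invariant of the simulation: if the simulated machine halts from here, then `D`. -/
def Inv (M : Λ → Stmt (fun _ : K => Γ) Λ σ) (T : Set (Stmt (fun _ : K => Γ) Λ σ)) (D : Prop) :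
    Config (Control K σ T) (Option K) (Option Γ) → Prop
  | (none, _) => D
  | (some (none, q, v), ν) => ∃ S : K → List Γ,
      (∀ k, ν (some k) = (S k).map some ++ [none]) ∧
      ((StateTransition.eval (step M) (stepAux q.1 v S)).Dom → D)
  | (some (some k, q, v), ν) => ∃ (S : K → List Γ) (u w : List Γ), S k = w ++ u ∧
      (∀ k' ≠ k, ν (some k') = (S k').map some ++ [none]) ∧
      ν (some k) = u.map some ++ none :: w.map some ∧
      ((StateTransition.eval (step M) (stepAux q.1 v S)).Dom → D)

theorem eval_halt_dom (v : σ) (S : K → List Γ) :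
    (StateTransition.eval (step M) (⟨none, v, S⟩ : Cfg _ _ _)).Dom :=
  Part.dom_iff_mem.mpr ⟨_, StateTransition.mem_eval.mpr ⟨.refl, rfl⟩⟩

theorem eval_goto (l : Λ) (v : σ) (S : K → List Γ) :
    StateTransition.eval (step M) (⟨some l, v, S⟩ : Cfg _ _ _) =
      StateTransition.eval (step M) (stepAux (M l) v S) :=
  StateTransition.reaches_eval (.single rfl)

/-- Arrivals touch only the channel `none`, which `Inv` ignores. Before halting, the control state
and the head letter determine every other move, and it agrees with the machine; hence no spurious
run can reach `halted`. -/
theorem Inv.step {D : Prop} {u v : Config (Control K σ T) (Option K) (Option Γ)}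
    (hu : Inv M T D u) (h : POCS.Step (Rule M T) u v) : Inv M T D v := by
  obtain ⟨t, ht, he, rfl⟩ := h
  obtain ⟨s, ν⟩ := u
  cases ht with
  | arrival s' =>
    obtain ⟨rfl, -⟩ := he
    obtain _ | ⟨_ | k, q, v⟩ := s <;> simpa [Inv, Transition.fire] using hu
  | push k f q v h h' =>
    obtain ⟨rfl, -⟩ := he
    obtain ⟨S, hS, hD⟩ := hu
    -- The old stack still stands before the marker, the pushed letter behind it.
    refine ⟨Function.update S k (f v :: S k), S k, [f v], by simp, fun k' hk' => ?_, ?_, hD⟩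
    · simp [hk', hS]
    · simp [hS]
  | peek k f q v h h' g =>
    obtain ⟨rfl, w, hw⟩ := he
    obtain ⟨S, hS, hD⟩ := hu
    rcases hk : S k with _ | ⟨g', l⟩
    · simp [hS, hk] at hw
    have hg : g' = g := by simp [hS, hk] at hw; exact hw.1
    subst hg
    refine ⟨S, l, [g'], by simp [hk], fun k' hk' => ?_, ?_, ?_⟩
    · simp [hk', hS]
    · simp [hS, hk]
    · simpa [hk] using hD
  | peekEmpty k f q v h h' =>
    obtain ⟨rfl, w, hw⟩ := he
    obtain ⟨S, hS, hD⟩ := hu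
    rcases hk : S k with _ | ⟨g', l⟩
    · refine ⟨S, fun k' => ?_, by simpa [hk] using hD⟩
      by_cases hk' : k' = k
      · subst hk'; simp [hS, hk]
      · simp [hk', hS]
    · simp [hS, hk] at hw
  | pop k f q v h h' g =>
    obtain ⟨rfl, w, hw⟩ := he
    obtain ⟨S, hS, hD⟩ := hu
    rcases hk : S k with _ | ⟨g', l⟩
    · simp [hS, hk] at hw
    have hg : g' = g := by simp [hS, hk] at hw; exact hw.1
    subst hg
    refine ⟨Function.update S k l, fun k' => ?_, by simpa [hk] using hD⟩
    by_cases hk' : k' = k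
    · subst hk'; simp [hS, hk]
    · simp [hk', hS]
  | popEmpty k f q v h h' =>
    obtain ⟨rfl, w, hw⟩ := he
    obtain ⟨S, hS, hD⟩ := hu
    rcases hk : S k with _ | ⟨g', l⟩
    · refine ⟨Function.update S k [], fun k' => ?_, by simpa [hk] using hD⟩
      by_cases hk' : k' = k
      · subst hk'; simp [hS, hk]
      · simp [hk', hS]
    · simp [hS, hk] at hw
  | load f q v h h' =>
    obtain ⟨rfl, -⟩ := he
    obtain ⟨S, hS, hD⟩ := hu
    exact ⟨S, fun k => by simp [hS], hD⟩
  | branch f q₁ q₂ v h h' =>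
    obtain ⟨rfl, -⟩ := he
    obtain ⟨S, hS, hD⟩ := hu
    refine ⟨S, fun k => by simp [hS], fun hd => hD ?_⟩
    rw [stepAux]
    cases hf : f v <;> simpa [hf] using hd
  | goto f v h h' =>
    obtain ⟨rfl, -⟩ := he
    obtain ⟨S, hS, hD⟩ := hu
    exact ⟨S, fun k => by simp [hS], fun hd => hD (by rwa [stepAux, eval_goto])⟩
  | halt v h =>
    obtain ⟨rfl, -⟩ := he
    obtain ⟨S, hS, hD⟩ := hu
    exact hD (eval_halt_dom v S)
  | rotate k q v g =>
    obtain ⟨rfl, x, hx⟩ := he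
    obtain ⟨S, u, w, hk, hS, hν, hD⟩ := hu
    obtain _ | ⟨g', l⟩ := u
    · simp [hν] at hx
    have hg : g' = g := by simp [hν] at hx; exact hx.1
    subst hg
    refine ⟨S, l, w ++ [g'], by simp [hk], fun k' hk' => ?_, ?_, hD⟩
    · simp [hk', hS]
    · simp [hν]
  | rotateEnd k q v =>
    obtain ⟨rfl, x, hx⟩ := he
    obtain ⟨S, u, w, hk, hS, hν, hD⟩ := hu
    obtain _ | ⟨g', l⟩ := u
    · refine ⟨S, fun k' => ?_, hD⟩
      by_cases hk' : k' = k
      · subst hk'; simp [hν, hk]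
      · simp [hk', hS]
    · simp [hν] at hx
  | clear c a =>
    obtain ⟨rfl, -⟩ := he
    exact hu

/-- The configurations of the channel system that represent configurations of `M`. -/
def Represents (M : Λ → Stmt (fun _ : K => Γ) Λ σ) (T : Set (Stmt (fun _ : K => Γ) Λ σ)) :
    Cfg (fun _ : K => Γ) Λ σ → Config (Control K σ T) (Option K) (Option Γ) → Prop
  | ⟨none, _, S⟩, s => s = (halted, channels S)
  | ⟨some l, v, S⟩, s => ∃ h : M l ∈ T, s = (run ⟨M l, h⟩ v, channels S)

open Relation

/-- A client arrives in the empty input channel and is consumed at once, so that the input channel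
is no obstacle to any silent move or push. -/
theorem reflTransGen_client {s s' : Control K σ T} {ν : Option K → List (Option Γ)} {c : Option K}
    {a : Option (Option Γ)} (hν : ν none = [])
    (h : Rule M T (s, none, some none, c, a, s')) :
    ReflTransGen (POCS.Step (Rule M T)) (s, ν) (s', Function.update ν c (ν c ++ a.toList)) := by
  refine .tail (.single ⟨_, .arrival s, ⟨rfl, ν none, by simp⟩, rfl⟩) ⟨_, h, ⟨rfl, [], ?_⟩, ?_⟩
  · simp [Transition.fire, hν]
  · have : Function.update ν none [] = ν := by rw [← hν, Function.update_eq_self]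
    simp [Transition.fire, hν, this]

/-- Letters move from `u`, before the marker, to the end of `w`, behind it; `w ++ u` is invariant,
and the marker moves last. -/
theorem reflTransGen_rotate (k : K) (q : T) (v : σ) {S : K → List Γ} (u : List Γ) :
    ∀ (w : List Γ), S k = w ++ u → ReflTransGen (POCS.Step (Rule M T))
      (rotate k q v, Function.update (channels S) (some k) (u.map some ++ none :: w.map some))
      (run q v, channels S) := by
  induction u with
  | nil =>
    intro w hk
    refine .single ⟨_, .rotateEnd k q v, ⟨rfl, w.map some, by simp⟩, ?_⟩
    have : channels S (some k) = w.map some ++ [none] := by simp [channels, hk]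
    simp [Transition.fire, ← this]
  | cons g u ih =>
    intro w hk
    refine .head ⟨_, .rotate k q v g, ⟨rfl, _, by simp; rfl⟩, ?_⟩ (ih (w ++ [g]) (by simp [hk]))
    simp [Transition.fire]

theorem channels_update (S : K → List Γ) (k : K) (l : List Γ) :
    channels (Function.update S k l) =
      Function.update (channels S) (some k) (l.map some ++ [none]) := by
  funext c
  obtain _ | k' := c
  · simp [channels]
  · by_cases h : k' = k
    · subst h; simp [channels]
    · simp [channels, h]

theorem exists_represents_stepAux (hT : Closed M T) (q : Stmt (fun _ : K => Γ) Λ σ) :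
    ∀ (h : q ∈ T) (v : σ) (S : K → List Γ), ∃ s, Represents M T (stepAux q v S) s ∧
      ReflTransGen (POCS.Step (Rule M T)) (run ⟨q, h⟩ v, channels S) s := by
  induction q with
  | push k f q ih =>
    intro h v S
    obtain ⟨s, hs, hr⟩ := ih (hT.push h) v (Function.update S k (f v :: S k))
    refine ⟨s, hs, .trans (reflTransGen_client rfl (.push k f q v h (hT.push h))) (.trans ?_ hr)⟩
    have := reflTransGen_rotate (M := M) k ⟨q, hT.push h⟩ v
      (S := Function.update S k (f v :: S k)) (S k) [f v] (by simp)
    rw [channels_update] at this ⊢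
    simpa [channels] using this
  | peek k f q ih =>
    intro h v S
    obtain ⟨s, hs, hr⟩ := ih (hT.peek h) (f v (S k).head?) S
    refine ⟨s, hs, .trans ?_ hr⟩
    rcases hk : S k with _ | ⟨g, l⟩
    · refine .single ⟨_, .peekEmpty k f q v h (hT.peek h), ⟨rfl, [], by simp [channels, hk]⟩, ?_⟩
      have : channels S (some k) = [none] := by simp [channels, hk]
      simp only [Transition.fire, this]
      simp [← this]
    · have := reflTransGen_rotate (M := M) k ⟨q, hT.peek h⟩ (f v (some g)) l [g] hk
      refine .head ⟨_, .peek k f q v h (hT.peek h) g, ⟨rfl, _, by simp [channels, hk]; rfl⟩, ?_⟩ this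
      simp [Transition.fire, channels, hk]
  | pop k f q ih =>
    intro h v S
    obtain ⟨s, hs, hr⟩ := ih (hT.pop h) (f v (S k).head?) (Function.update S k (S k).tail)
    refine ⟨s, hs, .trans ?_ hr⟩
    rcases hk : S k with _ | ⟨g, l⟩
    · refine .single ⟨_, .popEmpty k f q v h (hT.pop h), ⟨rfl, [], by simp [channels, hk]⟩, ?_⟩
      have : channels S (some k) = [none] := by simp [channels, hk]
      simp [Transition.fire, channels_update, this]
    · refine .single ⟨_, .pop k f q v h (hT.pop h) g, ⟨rfl, _, by simp [channels, hk]; rfl⟩, ?_⟩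
      simp [Transition.fire, channels, hk, channels_update]
  | load f q ih =>
    intro h v S
    obtain ⟨s, hs, hr⟩ := ih (hT.load h) (f v) S
    refine ⟨s, hs, .trans ?_ hr⟩
    simpa using reflTransGen_client (ν := channels S) rfl (.load f q v h (hT.load h))
  | branch f q₁ q₂ ih₁ ih₂ =>
    intro h v S
    have h' := hT.branch h v
    have hc := reflTransGen_client (M := M) (ν := channels S) rfl (.branch f q₁ q₂ v h h')
    simp only [Option.toList_none, List.append_nil, Function.update_eq_self] at hc
    have : ∃ s, Represents M T (stepAux (bif f v then q₁ else q₂) v S) s ∧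
        ReflTransGen (POCS.Step (Rule M T)) (run ⟨_, h'⟩ v, channels S) s := by
      -- The target state carries the membership proof `h'`, whose type depends on `f v`.
      revert h'
      cases f v
      · exact fun h' _ => ih₂ h' v S
      · exact fun h' _ => ih₁ h' v S
    obtain ⟨s, hs, hr⟩ := this
    refine ⟨s, ?_, hc.trans hr⟩
    rw [stepAux]
    cases hf : f v <;> simpa [hf] using hs
  | goto f =>
    intro h v S
    refine ⟨_, ⟨hT.goto h v, rfl⟩, ?_⟩
    simpa using reflTransGen_client (ν := channels S) rfl (.goto f v h (hT.goto h v))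
  | halt =>
    intro h v S
    refine ⟨_, rfl, ?_⟩
    simpa using reflTransGen_client (ν := channels S) rfl (.halt v h)

theorem exists_represents_of_reaches (hT : Closed M T) {c c' : Cfg (fun _ : K => Γ) Λ σ}
    (h : StateTransition.Reaches (step M) c c') {s} (hs : Represents M T c s) :
    ∃ s', Represents M T c' s' ∧ ReflTransGen (POCS.Step (Rule M T)) s s' := by
  induction h with
  | refl => exact ⟨s, hs, .refl⟩
  | @tail c₁ c₂ _ h ih =>
    obtain ⟨s', hs', hr⟩ := ih
    obtain ⟨_ | l, v, S⟩ := c₁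
    · simp at h
    · obtain ⟨hl, rfl⟩ := hs'
      obtain rfl : stepAux (M l) v S = c₂ := by simpa using h
      obtain ⟨s'', hs'', hr'⟩ := exists_represents_stepAux hT _ hl v S
      exact ⟨s'', hs'', hr.trans hr'⟩

theorem reflTransGen_clear_channel (c : Option K) (l : List (Option Γ)) :
    ∀ ν : Option K → List (Option Γ), ν c = l → ReflTransGen (POCS.Step (Rule M T))
      (halted, ν) (halted, Function.update ν c []) := by
  induction l with
  | nil => intro ν h; simp [← h, ReflTransGen.refl]
  | cons a l ih =>
    intro ν h
    have := ih (Function.update ν c l) (by simp)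
    rw [Function.update_idem] at this
    refine .head ⟨_, .clear c a, ⟨rfl, l, by simp [h]⟩, ?_⟩ this
    simp [Transition.fire, h]

theorem reflTransGen_clear [Finite K] (ν : Option K → List (Option Γ)) :
    ReflTransGen (POCS.Step (Rule M T)) (halted, ν) (halted, fun _ => []) := by
  have := Fintype.ofFinite (Option K)
  have key (s : Finset (Option K)) : ReflTransGen (POCS.Step (Rule M T)) (halted, ν)
      (halted, fun c => if c ∈ s then [] else ν c) := by
    induction s using Finset.induction_on with
    | empty => simp [ReflTransGen.refl]
    | insert c s _ ih =>
      refine ih.trans ?_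
      convert reflTransGen_clear_channel c _ _ rfl using 2
      funext c'
      by_cases hc : c' = c
      · subst hc; simp
      · simp [hc]
  simpa using key Finset.univ

/-- For the forward direction, `Inv` is used with `D` the halting of `c` itself: it is trivial at
the start and is the claim at `halted`. -/
theorem reflTransGen_iff_dom [Finite K] (hT : Closed M T) {c : Cfg (fun _ : K => Γ) Λ σ} {s}
    (hs : Represents M T c s) :
    ReflTransGen (POCS.Step (Rule M T)) s (halted, fun _ => []) ↔
      (StateTransition.eval (step M) c).Dom := by
  constructor
  · intro h
    have h₀ : Inv M T (StateTransition.eval (step M) c).Dom s := by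
      obtain ⟨_ | l, v, S⟩ := c
      · obtain rfl := hs
        exact eval_halt_dom v S
      · obtain ⟨hl, rfl⟩ := hs
        exact ⟨S, fun k => rfl, fun hd => by rwa [eval_goto]⟩
    have h₁ {s'} (h : ReflTransGen (POCS.Step (Rule M T)) s s') :
        Inv M T (StateTransition.eval (step M) c).Dom s' := by
      induction h with
      | refl => exact h₀
      | tail _ h ih => exact ih.step h
    exact h₁ h
  · intro h
    obtain ⟨c', hc'⟩ := Part.dom_iff_mem.mp h
    obtain ⟨hr, hn⟩ := StateTransition.mem_eval.mp hc'
    obtain ⟨s', hs', hr'⟩ := exists_represents_of_reaches hT hr hs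
    obtain ⟨_ | l, v, S⟩ := c'
    · obtain rfl := hs'
      exact hr'.trans (reflTransGen_clear _)
    · simp at hn

end StackSimulation

/-! ### Computability of the initial configuration, and a universal program. -/

namespace StackSimulation

open Turing Turing.PartrecToTM2

theorem trNat_eq_cons {n : ℕ} (hn : n ≠ 0) :
    trNat n = (bif n.bodd then Γ'.bit1 else Γ'.bit0) :: trNat n.div2 := by
  obtain ⟨b, m, rfl⟩ : ∃ b m, n = Nat.bit b m := ⟨n.bodd, n.div2, by simp⟩
  simp only [Nat.bodd_bit, Nat.div2_bit, trNat, ← Num.ofNat'_eq, Num.ofNat'_bit]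
  cases h : Num.ofNat' m with
  | zero =>
    rw [Num.ofNat'_eq] at h
    have : m = 0 := by exact_mod_cast (show (m : Num) = 0 from h)
    subst this
    cases b
    · simp at hn
    · rfl
  | pos p => cases b <;> rfl

/-- Course-of-values recursion along `n ↦ n.div2`, one binary digit at a time. -/
theorem primrec_map_trNat {α : Type} [Primcodable α] (φ : Γ' → α) :
    Primrec fun n => (trNat n).map φ := by
  -- `l` lists the values at all smaller arguments, so its length is the current argument.
  let g (l : List (List α)) : Option (List α) :=
    bif l.length == 0 then some [] else
      (l[l.length.div2]?).map fun r => (bif l.length.bodd then φ .bit1 else φ .bit0) :: r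
  have hg : Primrec g := by
    refine .cond (Primrec.beq.comp .list_length (.const 0)) (.const _) (.option_map ?_ ?_)
    · exact Primrec.list_getElem?.comp .id (Primrec.nat_div2.comp .list_length)
    · refine Primrec.list_cons.comp (.cond ?_ (.const _) (.const _)) .snd
      exact Primrec.nat_bodd.comp (Primrec.list_length.comp .fst)
  have := Primrec.nat_strong_rec (fun (_ : Unit) n => (trNat n).map φ)
    (g := fun _ l => g l) (hg.comp .snd) fun _ n => ?_
  · exact this.comp (.const ()) .id
  · rcases eq_or_ne n 0 with rfl | hn
    · simp [g]
    · have : n.div2 < n := by rw [Nat.div2_val]; omega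
      simp only [g, List.length_map, List.length_range, List.getElem?_map,
        List.getElem?_range this, beq_eq_false_iff_ne.mpr hn, cond_false, trNat_eq_cons hn]
      cases n.bodd <;> simp

/-- A code for a function on lists with undecidable halting problem. -/
theorem exists_code_dom_iff : ∃ c : ToPartrec.Code, ∀ e : Nat.Partrec.Code,
    (c.eval [Encodable.encode e]).Dom ↔ (e.eval 0).Dom := by
  have h : Nat.Partrec fun n => (Denumerable.ofNat Nat.Partrec.Code n).eval 0 :=
    Partrec.nat_iff.mp (Nat.Partrec.Code.eval_part.comp (Computable.ofNat _) (.const 0))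
  obtain ⟨c, hc⟩ := ToPartrec.Code.exists_code
    (Nat.Partrec'.part_iff₁.mpr (Partrec.nat_iff.mpr h))
  refine ⟨c, fun e => ?_⟩
  have := hc (Encodable.encode e ::ᵥ List.Vector.nil)
  simp only [List.Vector.head_cons, Denumerable.ofNat_encode] at this
  change (c.eval [Encodable.encode e]) = _ at this
  rw [this]
  rfl

instance : Finite K' :=
  Finite.of_injective (β := Fin 4) (fun | .main => 0 | .rev => 1 | .aux => 2 | .stack => 3) <| by
    rintro (_ | _ | _ | _) (_ | _ | _ | _) <;> simp

end StackSimulation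

open StackSimulation Turing Turing.PartrecToTM2 in
theorem mainTheorem11 :
    ¬ ∃ f : ReachInput →. Bool, Partrec f ∧
      ∀ (n m k : ℕ) (S : POCS (Fin n) (Fin m) (Fin k))
        (s₀ s₁ : Config (Fin n) (Fin m) (Fin k)) (x : ReachInput),
        Describes x S s₀ s₁ → ∃ b ∈ f x, (b = true ↔ S.Reachable s₀ s₁) := by
  rintro ⟨f, hf, H⟩
  obtain ⟨c, hc⟩ := exists_code_dom_iff
  have hsupp := tr_supports c .halt
  set T : Set (TM2.Stmt (fun _ : K' => Γ') Λ' (Option Γ')) :=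
    {q | some q ∈ TM2.stmts tr (codeSupp c .halt)} with hT
  -- The notion of support takes the default label as entry point, hence the explicit instance.
  have hclosed : Closed tr T := @closed_stmts _ _ _ _ ⟨trNormal c .halt⟩ _ _ hsupp
  have hmem : tr (trNormal c .halt) ∈ T := by
    simp only [hT, TM2.stmts, Finset.some_mem_insertNone, Finset.mem_biUnion]
    exact ⟨_, hsupp.1, TM2.stmts₁_self⟩
  have : Finite T :=
    ((TM2.stmts tr (codeSupp c .halt)).finite_toSet.preimage
      (Option.some_injective _).injOn).to_subtype
  let eQ := Finite.equivFin (Control K' (Option Γ') T)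
  let eC := Finite.equivFin (Option K')
  let eA := Finite.equivFin (Option Γ')
  let start (n : ℕ) : Config (Control K' (Option Γ') T) (Option K') (Option Γ') :=
    (run ⟨_, hmem⟩ none, channels (K'.elim (trList [n]) [] [] []))
  let S := POCS.ofRule eQ eC eA (isOpen_rule tr T)
  let code (n : ℕ) := codeConfig (POCS.relabelConfig eQ eC eA (start n))
  let input (n : ℕ) : ReachInput := ((Nat.card (Control K' (Option Γ') T),
    Nat.card (Option K'), Nat.card (Option Γ')), ((eC none : ℕ), (eA none : ℕ)),
    S.trans.toList.map codeTrans, Nat.Partrec.Code.const (Nat.pair 1 1), code n,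
    codeConfig (POCS.relabelConfig eQ eC eA (halted, fun _ => [])))
  have hcode : Primrec code := by
    refine .pair (.const (eQ (run ⟨_, hmem⟩ none) : ℕ)) (.list_ofFn fun i => ?_)
    simp only [POCS.relabelConfig_apply, start]
    -- Input channel, `main`, `rev`, `aux`, `stack`: only `main` depends on `n`.
    rcases eC.symm i with _ | _ | _ | _ | _
    · simpa [channels] using .const _
    · simp only [channels, K'.elim, trList, List.map_append, List.map_map, List.map_cons,
        List.append_assoc]
      exact Primrec.list_append.comp (primrec_map_trNat _) (.const _)
    all_goals exact .const _
  have hinput : Computable input :=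
    (Primrec.pair (.const _) <| .pair (.const _) <| .pair (.const _) <| .pair (.const _) <|
      .pair hcode (.const _)).to_comp
  have hreach (e : Nat.Partrec.Code) :
      ∃ b ∈ f (input (Encodable.encode e)), (b = true ↔ (e.eval 0).Dom) := by
    obtain ⟨b, hb, h⟩ := H _ _ _ S _ _ _ (POCS.describes_ofRule eQ eC eA (isOpen_rule tr T)
      (POCS.relabelConfig eQ eC eA (start (Encodable.encode e)))
      (POCS.relabelConfig eQ eC eA (halted, fun _ => [])))
    refine ⟨b, hb, h.trans ?_⟩
    rw [POCS.reachable_ofRule_iff, ← hc, reflTransGen_iff_dom hclosed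
      (c := init c [Encodable.encode e]) ⟨hmem, rfl⟩, tr_eval]
    rfl
  choose b hb hiff using hreach
  -- `f` may diverge on data that describe no system, but along `input` it is total and agrees with
  -- `b`.
  refine ComputablePred.halting_problem 0 (ComputablePred.computable_iff.mpr ⟨b, ?_, ?_⟩)
  · refine Partrec.of_eq (hf.comp (hinput.comp .encode)) fun e => ?_
    exact Part.eq_some_iff.mpr (hb e)
  · funext e
    exact propext (hiff e).symm
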